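/- Let $\mathcal X,\mathcal Y$ be finite-dimensional real inner product spaces and let $\mathcal S^n$ be the space of real symmetric $n\times n$ matrices with the Frobenius inner product, $\mathcal S^n_+$ its cone of positive semidefinite matrices and $\mathcal S^n_-=-\mathcal S^n_+$. Let $f:\mathcal X\to\mathbb R$, $h:\mathcal X\to\mathcal Y$, $G:\mathcal X\to\mathcal S^n$ be twice continuously differentiable and consider the problem $$\min_{x\in\mathcal X} f(x)\quad\text{subject to}\quad h(x)=0,\; G(x)\in\mathcal S^n_+ .$$ Put $L(x,y,\Gamma)=f(x)+\langle y,h(x)\rangle+\langle\Gamma,G(x)\rangle$, $\Phi(x)=(h(x),G(x))$, $\mathcal K=\{0\}\times\mathcal S^n_+\subset\mathcal Y\times\mathcal S^n$ (with the Euclidean product norm), and for $\lambda=(y,\Gamma)\in\mathcal Y\times\mathcal S^n$ and $\rho>0$ let $$\mathscr L(x,\lambda,\rho)=f(x)+\frac{\rho}{2}\,\mathrm{dist}^2\!\Big(\Phi(x)+\frac{\lambda}{\rho},\mathcal K\Big)-\frac{\|\lambda\|^2}{2\rho}$$ be the augmented Lagrangian. For $x\in\mathcal X$ let $\mathcal M(x)$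 be the set of all $(y,\Gamma)$ with $\nabla_xL(x,y,\Gamma)=0$, $h(x)=0$, $G(x)\in\mathcal S^n_+$, $\Gamma\in\mathcal S^n_-$ and $\langle G(x),\Gamma\rangle=0$; $x$ is called stationary if $\mathcal M(x)\neq\varnothing$. Let $\bar x$ be stationary and $\bar\lambda=(\bar y,\overline\Gamma)\in\mathcal M(\bar x)$. Suppose that the second order sufficient condition (SOSC) holds at $(\bar x,\bar\lambda)$, i.e. $$\langle\nabla^2_{xx}L(\bar x,\bar y,\overline\Gamma)d,d\rangle-2\big\langle\overline\Gamma,(\nabla G(\bar x)d)\,G(\bar x)^{\dagger}\,(\nabla G(\bar x)d)\big\rangle>0$$ for every $d\neq0$ with $\nabla h(\bar x)d=0$, $\nabla G(\bar x)d\in T_{\mathcal S^n_+}(G(\bar x))$ and $\langle\overline\Gamma,\nabla G(\bar x)d\rangle=0$, where $T_{\mathcal S^n_+}(G(\bar x))$ is the Bouligand tangent cone and $G(\bar x)^\dagger$ the Moore–Penrose generalized inverse. Then there are constants $\tau,\rho_3,\hat r>0$ such that for every $\rho\ge\rho_3$ and every $\lambda$ with $\|\lambda-\bar\lambda\|\le\hat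 r/(2\tau)$ the set $$\mathcal S_\rho(\lambda)=\arg\min\{\mathscr L(x,\lambda,\rho): \|x-\bar x\|\le\hat r\}$$ satisfies $$\varnothing\neq\mathcal S_\rho(\lambda)\subseteq\operatorname{int}\mathbb B_{\hat r}(\bar x)\qquad\text{and}\qquad \|u-\bar x\|\le\tau\|\lambda-\bar\lambda\|\ \text{ for all }u\in\mathcal S_\rho(\lambda),$$ where $\mathbb B_{\hat r}(\bar x)$ is the closed ball of radius $\hat r$ around $\bar x$. -/

import Mathlib

open scoped RealInnerProductSpace Topology
open Filter

namespace NLSDP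

noncomputable section

/-! ### Symmetric matrices with the Frobenius inner product -/

/-- The `n × n` real symmetric matrices, as a subspace of the Euclidean space of all `n × n` real
arrays.  The inherited inner product is `∑ i j, A i j * B i j`. -/
def symSubmodule (n : ℕ) : Submodule ℝ (EuclideanSpace ℝ (Fin n × Fin n)) where
  carrier := {A | ∀ i j, A (i, j) = A (j, i)}
  add_mem' := by
    intro A B hA hB i j
    simp only [PiLp.add_apply]
    rw [hA i j, hB i j]
  zero_mem' := by
    intro i j
    simp
  smul_mem' := by
    intro c A hA i j
    simp only [PiLp.smul_apply]
    rw [hA i j]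

/-- The Euclidean space `𝒮ⁿ` of real symmetric matrices with the Frobenius inner product. -/
abbrev SymMat (n : ℕ) : Type := symSubmodule n

/-- The underlying matrix. -/
def SymMat.toMat {n : ℕ} (A : SymMat n) : Matrix (Fin n) (Fin n) ℝ :=
  Matrix.of fun i j => (A : EuclideanSpace ℝ (Fin n × Fin n)) (i, j)

theorem SymMat.isHermitian {n : ℕ} (A : SymMat n) : A.toMat.IsHermitian := by
  ext i j
  simpa [SymMat.toMat] using A.2 j i

/-- The inner product of `𝒮ⁿ` is the Frobenius inner product `tr (A B)`. -/
theorem SymMat.inner_eq_trace {n : ℕ} (A B : SymMat n) :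
    ⟪A, B⟫ = (A.toMat * B.toMat).trace := by
  have h : ⟪A, B⟫ = ⟪(A : EuclideanSpace ℝ (Fin n × Fin n)), (B : EuclideanSpace ℝ _)⟫ := rfl
  rw [h, PiLp.inner_apply, Fintype.sum_prod_type]
  simp only [Matrix.trace, Matrix.diag, Matrix.mul_apply, SymMat.toMat, Matrix.of_apply]
  refine Finset.sum_congr rfl fun i _ => Finset.sum_congr rfl fun j _ => ?_
  rw [B.2 i j]
  simp [mul_comm]

/-- The positive semidefinite cone `𝒮ⁿ₊`. -/
def psdCone (n : ℕ) : Set (SymMat n) := {A | A.toMat.PosSemidef}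

/-- The Moore–Penrose generalized inverse `A†` of a symmetric matrix: in an orthonormal basis of
eigenvectors, invert the nonzero eigenvalues and keep the zero ones (`0⁻¹ = 0`). -/
def pinv {n : ℕ} (A : SymMat n) : Matrix (Fin n) (Fin n) ℝ :=
  A.isHermitian.eigenvectorUnitary.1 *
    Matrix.diagonal (fun i => (A.isHermitian.eigenvalues i)⁻¹) *
    star A.isHermitian.eigenvectorUnitary.1

/-- `pinv A` satisfies the four Penrose equations. -/
theorem pinv_penrose {n : ℕ} (A : SymMat n) :
    A.toMat * pinv A * A.toMat = A.toMat ∧ pinv A * A.toMat * pinv A = pinv A ∧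
      (A.toMat * pinv A).IsHermitian ∧ (pinv A * A.toMat).IsHermitian := by
  set U : Matrix (Fin n) (Fin n) ℝ := A.isHermitian.eigenvectorUnitary.1 with hU
  set e := A.isHermitian.eigenvalues with he
  have hUU : star U * U = 1 := Unitary.coe_star_mul_self A.isHermitian.eigenvectorUnitary
  have hA : A.toMat = U * Matrix.diagonal e * star U := by
    have h := A.isHermitian.spectral_theorem
    rw [Unitary.conjStarAlgAut_apply] at h
    simpa using h
  have hP : pinv A = U * Matrix.diagonal (fun i => (e i)⁻¹) * star U := rfl
  have hmul : ∀ a b : Fin n → ℝ, (U * Matrix.diagonal a * star U) * (U * Matrix.diagonal b * star U)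
      = U * Matrix.diagonal (fun i => a i * b i) * star U := by
    intro a b
    calc (U * Matrix.diagonal a * star U) * (U * Matrix.diagonal b * star U)
        = U * Matrix.diagonal a * (star U * U) * Matrix.diagonal b * star U := by
          simp only [Matrix.mul_assoc]
      _ = _ := by rw [hUU, Matrix.mul_one, Matrix.mul_assoc U, Matrix.diagonal_mul_diagonal]
  have hherm : ∀ a : Fin n → ℝ, (U * Matrix.diagonal a * star U).IsHermitian := by
    intro a
    have := Matrix.isHermitian_mul_mul_conjTranspose U (Matrix.isHermitian_diagonal a)
    simpa [Matrix.star_eq_conjTranspose] using this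
  rw [hP, hA]
  simp only [hmul]
  refine ⟨?_, ?_, hherm _, hherm _⟩
  · congr 3
    funext i
    exact mul_inv_mul_cancel (e i)
  · congr 3
    funext i
    simpa using mul_inv_mul_cancel (e i)⁻¹

/-! ### Tangent and critical cones -/

/-- The Bouligand tangent (contingent) cone of `C` at `x`. -/
def tangentCone {E : Type*} [NormedAddCommGroup E] [InnerProductSpace ℝ E] (C : Set E) (x : E) :
    Set E :=
  {d | ∃ (t : ℕ → ℝ) (e : ℕ → E), (∀ k, 0 < t k) ∧ Tendsto t atTop (𝓝 0) ∧
    Tendsto e atTop (𝓝 d) ∧ ∀ k, x + t k • e k ∈ C}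

/-- The critical cone `T_C(x) ∩ y^⊥` of `C` at `x` associated with a normal vector `y`. -/
def criticalCone {E : Type*} [NormedAddCommGroup E] [InnerProductSpace ℝ E] (C : Set E)
    (x y : E) : Set E :=
  {d | d ∈ tangentCone C x ∧ ⟪y, d⟫ = 0}

/-! ### The nonlinear semidefinite program `min f(x)` subject to `h(x) = 0`, `G(x) ∈ 𝒮ⁿ₊` -/

section

variable {X Y : Type*} [NormedAddCommGroup X] [InnerProductSpace ℝ X]
  [NormedAddCommGroup Y] [InnerProductSpace ℝ Y] {n : ℕ}

/-- `L(x, y, Γ) = f(x) + ⟨y, h(x)⟩ + ⟨Γ, G(x)⟩`; a multiplier `lam = (y, Γ)` lives in the Euclidean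
product space `Y × 𝒮ⁿ`. -/
def lagrangian (f : X → ℝ) (h : X → Y) (G : X → SymMat n) (lam : WithLp 2 (Y × SymMat n))
    (x : X) : ℝ :=
  f x + ⟪lam.fst, h x⟫ + ⟪lam.snd, G x⟫

/-- `𝓜(x)`: the multipliers `(y, Γ)` for which `(x, y, Γ)` satisfies the KKT conditions
`∇ₓL(x, y, Γ) = 0`, `h(x) = 0`, `𝒮ⁿ₊ ∋ G(x) ⊥ Γ ∈ 𝒮ⁿ₋`. -/
def multipliers (f : X → ℝ) (h : X → Y) (G : X → SymMat n) (x : X) :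
    Set (WithLp 2 (Y × SymMat n)) :=
  {lam | fderiv ℝ (lagrangian f h G lam) x = 0 ∧ h x = 0 ∧ G x ∈ psdCone n ∧
    ⟪G x, lam.snd⟫ = 0 ∧ -lam.snd ∈ psdCone n}

/-- The point `x` is stationary: it is part of some KKT triple. -/
def IsStationary (f : X → ℝ) (h : X → Y) (G : X → SymMat n) (x : X) : Prop :=
  (multipliers f h G x).Nonempty

/-- The critical cone of the program at `x` (for the multiplier `lam = (y, Γ)`). -/
def criticalDirections (h : X → Y) (G : X → SymMat n) (x : X) (lam : WithLp 2 (Y × SymMat n)) :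
    Set X :=
  {d | fderiv ℝ h x d = 0 ∧ fderiv ℝ G x d ∈ criticalCone (psdCone n) (G x) lam.snd}

/-- The sigma term `2 ⟨Γ, B A† B⟩`. -/
def sigmaTerm (A Γ B : SymMat n) : ℝ :=
  2 * (Γ.toMat * (B.toMat * pinv A * B.toMat)).trace

/-- The second order sufficient condition at `(x, lam)`. -/
def SOSC (f : X → ℝ) (h : X → Y) (G : X → SymMat n) (x : X)
    (lam : WithLp 2 (Y × SymMat n)) : Prop :=
  ∀ d ∈ criticalDirections h G x lam, d ≠ 0 →
    0 < fderiv ℝ (fderiv ℝ (lagrangian f h G lam)) x d d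
      - sigmaTerm (G x) lam.snd (fderiv ℝ G x d)

/-- `𝓚 = {0} × 𝒮ⁿ₊`. -/
def coneK (Y : Type*) [NormedAddCommGroup Y] (n : ℕ) : Set (WithLp 2 (Y × SymMat n)) :=
  {z | z.fst = 0 ∧ z.snd ∈ psdCone n}

/-- `Φ(x) = (h(x), G(x))`. -/
def constraintMap (h : X → Y) (G : X → SymMat n) (x : X) : WithLp 2 (Y × SymMat n) :=
  WithLp.toLp 2 (h x, G x)

/-- The augmented Lagrangian
`𝓛(x, lam, ρ) = f(x) + (ρ/2) dist²(Φ(x) + lam/ρ, 𝓚) - ‖lam‖²/(2ρ)`. -/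
def augLagrangian (f : X → ℝ) (h : X → Y) (G : X → SymMat n) (lam : WithLp 2 (Y × SymMat n))
    (ρ : ℝ) (x : X) : ℝ :=
  f x + ρ / 2 * Metric.infDist (constraintMap h G x + ρ⁻¹ • lam) (coneK Y n) ^ 2
    - ‖lam‖ ^ 2 / (2 * ρ)

/-- The set of minimizers of `𝓛(·, lam, ρ)` over the closed ball of radius `r` around `c`. -/
def localSolutions (f : X → ℝ) (h : X → Y) (G : X → SymMat n) (c : X) (r : ℝ)
    (lam : WithLp 2 (Y × SymMat n)) (ρ : ℝ) : Set X :=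
  {u | u ∈ Metric.closedBall c r ∧ IsMinOn (augLagrangian f h G lam ρ) (Metric.closedBall c r) u}

end

end

end NLSDP

namespace NLSDP

noncomputable section

/-! SOSC yields a quadratic growth estimate with an explicit slack `z ∈ 𝓚` in place of the distance
(`exists_quadratic_growth`): near `x₀`, `f x + ⟪lam, Φ x - z⟫ + ‖Φ x - z‖² / (2c)` exceeds `f x₀` by
at least `c ‖x - x₀‖²`. If it failed for every `c`, the normalised violating points would converge
to a critical direction (`false_of_seq`). The Taylor expansion of the Lagrangian supplies the
Hessian term, and `sq_mul_le_neg_inner` with `tendsto_curvature` the sigma term, so that direction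
contradicts SOSC.

For the theorem, a minimizer `u` has value at most `f xbar`. Growth at the projection of `Φ u + lam
/ ρ` onto `𝓚` then bounds `‖u - xbar‖`, once the error from replacing `lambar` by `lam` is absorbed
by one extra unit of penalty. Since minimization over `z` is never differentiated, no smoothness of
the distance is needed. -/

/-! ### Traces of products of positive semidefinite matrices. -/

open scoped MatrixOrder in
theorem exists_eq_conjTranspose_mul_self {n : ℕ} {N : Matrix (Fin n) (Fin n) ℝ}
    (hN : N.PosSemidef) : ∃ C : Matrix (Fin n) (Fin n) ℝ, N = C.conjTranspose * C :=
  CStarAlgebra.nonneg_iff_eq_star_mul_self.mp hN.nonneg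

theorem trace_mul_nonneg {n : ℕ} {N Z : Matrix (Fin n) (Fin n) ℝ} (hN : N.PosSemidef)
    (hZ : Z.PosSemidef) : 0 ≤ (N * Z).trace := by
  obtain ⟨C, rfl⟩ := exists_eq_conjTranspose_mul_self hN
  rw [Matrix.mul_assoc, Matrix.trace_mul_comm]
  exact (hZ.mul_mul_conjTranspose_same C).trace_nonneg

/-- With `N = CᴴC` and `A = DᴴD`, the trace of `N * A` is the squared Frobenius norm of `C * Dᴴ`. -/
theorem mul_eq_zero_of_trace_mul_eq_zero {n : ℕ} {N A : Matrix (Fin n) (Fin n) ℝ}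
    (hN : N.PosSemidef) (hA : A.PosSemidef) (h : (N * A).trace = 0) : N * A = 0 := by
  obtain ⟨C, rfl⟩ := exists_eq_conjTranspose_mul_self hN
  obtain ⟨D, rfl⟩ := exists_eq_conjTranspose_mul_self hA
  have h' : ((C * D.conjTranspose) * (C * D.conjTranspose).conjTranspose).trace = 0 := by
    rw [← h, Matrix.mul_assoc C.conjTranspose, Matrix.trace_mul_comm C.conjTranspose]
    simp [Matrix.mul_assoc]
  rw [Matrix.trace_mul_conjTranspose_self_eq_zero_iff] at h'
  calc _ = C.conjTranspose * (C * D.conjTranspose) * D := by simp [Matrix.mul_assoc]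
    _ = 0 := by rw [h', Matrix.mul_zero, Matrix.zero_mul]

theorem pinv_isHermitian {n : ℕ} (A : SymMat n) : (pinv A).IsHermitian := by
  have := Matrix.isHermitian_mul_mul_conjTranspose A.isHermitian.eigenvectorUnitary.1
    (Matrix.isHermitian_diagonal fun i => (A.isHermitian.eigenvalues i)⁻¹)
  simpa [pinv, Matrix.star_eq_conjTranspose] using this

@[simp] theorem SymMat.toMat_add {n : ℕ} (A B : SymMat n) :
    (A + B).toMat = A.toMat + B.toMat := rfl

@[simp] theorem SymMat.toMat_smul {n : ℕ} (t : ℝ) (A : SymMat n) :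
    (t • A).toMat = t • A.toMat := rfl

@[simp] theorem SymMat.toMat_neg {n : ℕ} (A : SymMat n) : (-A).toMat = -A.toMat := rfl

theorem SymMat.continuous_toMat {n : ℕ} : Continuous (SymMat.toMat (n := n)) := by
  unfold SymMat.toMat
  refine continuous_matrix fun i j => ?_
  simp only [Matrix.of_apply]
  fun_prop

theorem isClosed_psdCone (n : ℕ) : IsClosed (psdCone n) := by
  have : psdCone n = ⋂ v : Fin n → ℝ, {A : SymMat n | 0 ≤ star v ⬝ᵥ A.toMat.mulVec v} := by
    ext A
    simp only [psdCone, Set.mem_ofPred_eq, Set.mem_iInter, Matrix.posSemidef_iff_dotProduct_mulVec]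
    exact ⟨fun h => h.2, fun h => ⟨A.isHermitian, h⟩⟩
  rw [this]
  refine isClosed_iInter fun v => isClosed_le continuous_const ?_
  have := SymMat.continuous_toMat (n := n)
  fun_prop

/-! ### Curvature of the semidefinite cone. -/

/-- A positive semidefinite `A + t • B'` cannot be too orthogonal to `-Γ`: the curvature of the
cone gives a lower bound of second order in `t`. -/
theorem sq_mul_le_neg_inner {n : ℕ} {A Γ : SymMat n} (hA : A ∈ psdCone n) (hΓ : -Γ ∈ psdCone n)
    (hAΓ : ⟪A, Γ⟫ = 0) (B B' : SymMat n) (t : ℝ) (hZ : A + t • B' ∈ psdCone n) :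
    t ^ 2 * (((A + t • B').toMat * (pinv A * B.toMat * Γ.toMat * B.toMat * pinv A)).trace
      - 2 * (Γ.toMat * (B.toMat * pinv A * B'.toMat)).trace) ≤ -⟪Γ, A + t • B'⟫ := by
  have hNA : Γ.toMat * A.toMat = 0 := by
    have := mul_eq_zero_of_trace_mul_eq_zero (N := (-Γ).toMat) hΓ hA (by
      rw [← SymMat.inner_eq_trace, inner_neg_left, real_inner_comm, hAΓ, neg_zero])
    simpa using this
  have hAN : A.toMat * Γ.toMat = 0 := by
    have := congrArg Matrix.conjTranspose hNA
    rwa [Matrix.conjTranspose_mul, A.isHermitian.eq, Γ.isHermitian.eq,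
      Matrix.conjTranspose_zero] at this
  -- Congruence of `A + t B'` by `1 - t A†B` stays positive semidefinite, so its pairing with `-Γ`
  -- is nonnegative. As `ΓA = AΓ = 0`, both cross terms carry a factor `t²`, and expanding the
  -- pairing gives the bound.
  have hM := trace_mul_nonneg (N := (-Γ).toMat) hΓ
    ((show (A + t • B').toMat.PosSemidef from hZ).conjTranspose_mul_mul_same
      (1 - t • (pinv A * B.toMat)))
  have hct : (1 - t • (pinv A * B.toMat)).conjTranspose = 1 - t • (B.toMat * pinv A) := by
    rw [Matrix.conjTranspose_sub, Matrix.conjTranspose_smul, Matrix.conjTranspose_mul,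
      (pinv_isHermitian A).eq, B.isHermitian.eq, Matrix.conjTranspose_one, star_trivial]
  rw [hct] at hM
  have e1 : (Γ.toMat * (B.toMat * pinv A * (A + t • B').toMat)).trace
      = t * (Γ.toMat * (B.toMat * pinv A * B'.toMat)).trace := by
    have : (Γ.toMat * (B.toMat * pinv A * A.toMat)).trace = 0 := by
      rw [← Matrix.mul_assoc, Matrix.trace_mul_comm, ← Matrix.mul_assoc, hAN]; simp
    simp [Matrix.mul_add, this]
  have e2 : (Γ.toMat * ((A + t • B').toMat * (pinv A * B.toMat))).trace
      = t * (Γ.toMat * (B.toMat * pinv A * B'.toMat)).trace := by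
    rw [← e1, ← Matrix.trace_transpose]
    have h1 : ∀ C : SymMat n, C.toMat.transpose = C.toMat := fun C => by
      simpa using C.isHermitian.eq
    have h2 : (pinv A).transpose = pinv A := by simpa using (pinv_isHermitian A).eq
    rw [Matrix.transpose_mul, Matrix.transpose_mul, Matrix.transpose_mul, h1, h1, h1, h2,
      Matrix.trace_mul_comm]
  have e3 : (Γ.toMat * (B.toMat * pinv A * (A + t • B').toMat * (pinv A * B.toMat))).trace
      = ((A + t • B').toMat * (pinv A * B.toMat * Γ.toMat * B.toMat * pinv A)).trace := by
    rw [Matrix.trace_mul_comm (A + t • B').toMat]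
    rw [show Γ.toMat * (B.toMat * pinv A * (A + t • B').toMat * (pinv A * B.toMat)) =
      (Γ.toMat * B.toMat * pinv A * (A + t • B').toMat) * (pinv A * B.toMat) by
        simp only [Matrix.mul_assoc], Matrix.trace_mul_comm]
    simp only [Matrix.mul_assoc]
  have e0 := SymMat.inner_eq_trace Γ (A + t • B')
  rw [e0]
  set Z := (A + t • B').toMat with hZdef
  have key : ((-Γ).toMat * ((1 - t • (B.toMat * pinv A)) * Z * (1 - t • (pinv A * B.toMat)))).trace
      = -(Γ.toMat * Z).trace + t * (Γ.toMat * (B.toMat * pinv A * Z)).trace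
        + t * (Γ.toMat * (Z * (pinv A * B.toMat))).trace
        - t ^ 2 * (Γ.toMat * (B.toMat * pinv A * Z * (pinv A * B.toMat))).trace := by
    simp only [SymMat.toMat_neg, Matrix.sub_mul, Matrix.mul_sub, Matrix.one_mul, Matrix.mul_one,
      Matrix.neg_mul, Matrix.smul_mul, Matrix.mul_smul, Matrix.trace_sub, Matrix.trace_neg,
      Matrix.trace_smul, smul_eq_mul, smul_sub]
    ring
  rw [key, e1, e2, e3] at hM
  nlinarith

/-- By `A†AA† = A†` the first trace tends to half the sigma term, while the second, with its factor
2, tends to the whole of it. -/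
theorem tendsto_curvature {n : ℕ} {A Γ : SymMat n} {t : ℕ → ℝ} {B : SymMat n} {B' : ℕ → SymMat n}
    (ht : Tendsto t atTop (𝓝 0)) (hB : Tendsto B' atTop (𝓝 B)) :
    Tendsto (fun k =>
      ((A + t k • B' k).toMat * (pinv A * B.toMat * Γ.toMat * B.toMat * pinv A)).trace
      - 2 * (Γ.toMat * (B.toMat * pinv A * (B' k).toMat)).trace) atTop
      (𝓝 (-(sigmaTerm A Γ B / 2))) := by
  have c := SymMat.continuous_toMat (n := n)
  have h1 : Tendsto (fun k => (A + t k • B' k).toMat) atTop (𝓝 A.toMat) := by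
    have := (tendsto_const_nhds (x := A)).add (ht.smul hB)
    rw [zero_smul, add_zero] at this
    exact (c.tendsto A).comp this
  have h2 : Tendsto (fun k => (B' k).toMat) atTop (𝓝 B.toMat) := (c.tendsto B).comp hB
  have hl : ∀ M : Matrix (Fin n) (Fin n) ℝ, Continuous fun X => (X * M).trace := fun M => by
    fun_prop
  have hr : ∀ M N : Matrix (Fin n) (Fin n) ℝ, Continuous fun X => (M * (N * X)).trace :=
    fun M N => by fun_prop
  have e : (A.toMat * (pinv A * B.toMat * Γ.toMat * B.toMat * pinv A)).trace
      = (Γ.toMat * (B.toMat * pinv A * B.toMat)).trace := by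
    conv_rhs => rw [← (pinv_penrose A).2.1]
    rw [show A.toMat * (pinv A * B.toMat * Γ.toMat * B.toMat * pinv A) =
      (A.toMat * pinv A * B.toMat) * (Γ.toMat * B.toMat * pinv A) by
        simp only [Matrix.mul_assoc], Matrix.trace_mul_comm]
    simp only [Matrix.mul_assoc]
  have h := (((hl (pinv A * B.toMat * Γ.toMat * B.toMat * pinv A)).tendsto _).comp h1).sub
    ((((hr Γ.toMat (B.toMat * pinv A)).tendsto _).comp h2).const_mul 2)
  have hval : -(sigmaTerm A Γ B / 2) =
      (Γ.toMat * (B.toMat * pinv A * B.toMat)).trace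
        - 2 * (Γ.toMat * (B.toMat * pinv A * B.toMat)).trace := by
    unfold sigmaTerm
    ring
  rw [e, ← hval] at h
  exact h

/-! ### Second order expansion, the Lagrangian and the cone `𝓚`. -/

/-- Second order Taylor expansion at a critical point. -/
theorem isLittleO_taylor_two {X : Type*} [NormedAddCommGroup X] [NormedSpace ℝ X] {L : X → ℝ}
    (hL : ContDiff ℝ 2 L) {x₀ : X} (h0 : fderiv ℝ L x₀ = 0) :
    (fun x => L x - L x₀ - 1 / 2 * fderiv ℝ (fderiv ℝ L) x₀ (x - x₀) (x - x₀)) =o[𝓝 x₀]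
      fun x => ‖x - x₀‖ ^ 2 := by
  set H := fderiv ℝ (fderiv ℝ L) x₀
  have hdiff : Differentiable ℝ L := hL.differentiable (by norm_num)
  have hd2 : Differentiable ℝ (fderiv ℝ L) :=
    (hL.fderiv_right (m := 1) (by norm_num)).differentiable (by norm_num)
  -- Symmetry makes `H (x - x₀)` the derivative of the quadratic term. The remainder's derivative is
  -- then `o(‖x - x₀‖)`, and the mean value inequality gains one more order.
  have hsymm : ∀ u v, H u v = H v u :=
    (hL.contDiffAt (x := x₀)).isSymmSndFDerivAt (by simp)
  have hq : ∀ x, HasFDerivAt (fun x => L x - L x₀ - 1 / 2 * H (x - x₀) (x - x₀))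
      (fderiv ℝ L x - H (x - x₀)) x := by
    intro x
    have hs : HasFDerivAt (fun x => x - x₀) (ContinuousLinearMap.id ℝ X) x :=
      (hasFDerivAt_id x).sub_const x₀
    have h1 := (((H.hasFDerivAt (x := x - x₀)).comp x hs).clm_apply hs).const_mul (1 / 2 : ℝ)
    refine (((hdiff x).hasFDerivAt.sub_const (L x₀)).sub h1).congr_fderiv ?_
    ext v
    have := hsymm v (x - x₀)
    simp only [Function.comp_apply, sub_apply, smul_apply,
      add_apply, ContinuousLinearMap.comp_apply, ContinuousLinearMap.id_apply,
      ContinuousLinearMap.flip_apply, smul_eq_mul, this]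
    ring
  have hlo := (hd2 x₀).hasFDerivAt.isLittleO
  rw [Asymptotics.isLittleO_iff] at hlo ⊢
  intro c hc
  obtain ⟨ε, hε, hball⟩ := Metric.eventually_nhds_iff_ball.mp (hlo hc)
  refine Metric.eventually_nhds_iff_ball.mpr ⟨ε, hε, fun x hx => ?_⟩
  have hx' : ‖x - x₀‖ < ε := by simpa [dist_eq_norm] using hx
  have hmv := (convex_closedBall x₀ ‖x - x₀‖).norm_image_sub_le_of_norm_hasFDerivWithin_le
    (f := fun x => L x - L x₀ - 1 / 2 * H (x - x₀) (x - x₀)) (C := c * ‖x - x₀‖)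
    (fun y _ => (hq y).hasFDerivWithinAt) (fun y hy => ?_)
    (Metric.mem_closedBall_self (norm_nonneg _)) (y := x) (by simp [dist_eq_norm])
  · simpa [pow_two, mul_assoc] using hmv
  · have hy' : ‖y - x₀‖ ≤ ‖x - x₀‖ := by simpa [dist_eq_norm] using hy
    have := hball y (by simpa [dist_eq_norm] using hy'.trans_lt hx')
    rw [h0, sub_zero] at this
    exact this.trans (by gcongr)

theorem lagrangian_eq_add_inner {X Y : Type*} [NormedAddCommGroup Y] [InnerProductSpace ℝ Y]
    {n : ℕ} (f : X → ℝ) (h : X → Y) (G : X → SymMat n)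
    (lam : WithLp 2 (Y × SymMat n)) (x : X) :
    lagrangian f h G lam x = f x + ⟪lam, constraintMap h G x⟫ := by
  simp [lagrangian, constraintMap, WithLp.prod_inner_apply, add_assoc]

theorem isClosed_coneK {Y : Type*} [NormedAddCommGroup Y] {n : ℕ} : IsClosed (coneK Y n) := by
  have h1 : Continuous fun z : WithLp 2 (Y × SymMat n) => z.fst := by fun_prop
  have h2 : Continuous fun z : WithLp 2 (Y × SymMat n) => z.snd := by fun_prop
  exact (isClosed_singleton.preimage h1).inter ((isClosed_psdCone n).preimage h2)

section

variable {X Y : Type*} [NormedAddCommGroup X] [InnerProductSpace ℝ X]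
  [NormedAddCommGroup Y] [InnerProductSpace ℝ Y] {n : ℕ}

theorem contDiff_lagrangian {f : X → ℝ} {h : X → Y} {G : X → SymMat n}
    (hf : ContDiff ℝ 2 f) (hh : ContDiff ℝ 2 h) (hG : ContDiff ℝ 2 G)
    (lam : WithLp 2 (Y × SymMat n)) : ContDiff ℝ 2 (lagrangian f h G lam) := by
  unfold lagrangian
  exact (hf.add (contDiff_const.inner ℝ hh)).add (contDiff_const.inner ℝ hG)

theorem inner_eq_fst_add_snd (lam z : WithLp 2 (Y × SymMat n)) :
    ⟪lam, z⟫ = ⟪lam.fst, z.fst⟫ + ⟪lam.snd, z.snd⟫ :=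
  WithLp.prod_inner_apply lam z

theorem inner_nonpos_of_mem_coneK {lam z : WithLp 2 (Y × SymMat n)} (hz : z ∈ coneK Y n)
    (hlam : -lam.snd ∈ psdCone n) : ⟪lam, z⟫ ≤ 0 := by
  have := trace_mul_nonneg (N := (-lam.snd).toMat) hlam hz.2
  rw [← SymMat.inner_eq_trace, inner_neg_left] at this
  rw [inner_eq_fst_add_snd, hz.1, inner_zero_right]
  linarith

theorem tendsto_inv_norm_smul_sub {E : Type*} [NormedAddCommGroup E] [NormedSpace ℝ E] {g : X → E}
    {x₀ d : X} (hg : DifferentiableAt ℝ g x₀) {x : ℕ → X} (hx : Tendsto x atTop (𝓝 x₀))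
    (hne : ∀ k, x k ≠ x₀) (hd : Tendsto (fun k => ‖x k - x₀‖⁻¹ • (x k - x₀)) atTop (𝓝 d)) :
    Tendsto (fun k => ‖x k - x₀‖⁻¹ • (g (x k) - g x₀)) atTop (𝓝 (fderiv ℝ g x₀ d)) := by
  have ht0 : Tendsto (fun k => ‖x k - x₀‖) atTop (𝓝 0) := by
    simpa using (hx.sub_const x₀).norm
  have hx0 : Tendsto (fun k => x k - x₀) atTop (𝓝 0) := by
    simpa using hx.sub_const x₀
  have hinv : Tendsto (fun k => ‖x k - x₀‖⁻¹) atTop atTop :=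
    tendsto_inv_nhdsGT_zero.comp (tendsto_nhdsWithin_iff.mpr
      ⟨ht0, Eventually.of_forall fun k => norm_pos_iff.mpr (sub_ne_zero.mpr (hne k))⟩)
  simpa using hg.hasFDerivAt.hasFDerivWithinAt.lim (s := Set.univ) (l := atTop) hx0
    (Eventually.of_forall fun _ => Set.mem_univ _) hd

/-! ### Quadratic growth by contradiction. -/

/-- The sequences violating quadratic growth produce a critical direction violating the second
order condition. -/
theorem false_of_seq {f : X → ℝ} {h : X → Y} {G : X → SymMat n}
    (hf : ContDiff ℝ 2 f) (hh : ContDiff ℝ 2 h) (hG : ContDiff ℝ 2 G)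
    {x₀ d : X} {lam : WithLp 2 (Y × SymMat n)} (hlam : lam ∈ multipliers f h G x₀)
    (hsosc : SOSC f h G x₀ lam) {x : ℕ → X} {z : ℕ → WithLp 2 (Y × SymMat n)} {s : ℕ → ℝ}
    (hs : Tendsto s atTop atTop) (hspos : ∀ k, 0 < s k)
    (hx : Tendsto x atTop (𝓝 x₀)) (hne : ∀ k, x k ≠ x₀)
    (hd : Tendsto (fun k => ‖x k - x₀‖⁻¹ • (x k - x₀)) atTop (𝓝 d))
    (hz : ∀ k, z k ∈ coneK Y n)
    (hlt : ∀ k, f (x k) + ⟪lam, constraintMap h G (x k) - z k⟫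
      + s k / 2 * ‖constraintMap h G (x k) - z k‖ ^ 2 < f x₀ + (s k)⁻¹ * ‖x k - x₀‖ ^ 2) :
    False := by
  obtain ⟨hL0, hh0, hG0, hGlam, hlamneg⟩ := hlam
  set A := G x₀
  set Γ := lam.snd
  set L := lagrangian f h G lam with hLdef
  set H := fderiv ℝ (fderiv ℝ L) x₀
  set t : ℕ → ℝ := fun k => ‖x k - x₀‖ with ht
  have htpos : ∀ k, 0 < t k := fun k => norm_pos_iff.mpr (sub_ne_zero.mpr (hne k))
  have ht0 : Tendsto t atTop (𝓝 0) := by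
    simpa [ht] using (hx.sub_const x₀).norm
  set w : ℕ → WithLp 2 (Y × SymMat n) := fun k => constraintMap h G (x k) - z k with hw
  have hdnorm : ‖d‖ = 1 := by
    refine tendsto_nhds_unique hd.norm (tendsto_const_nhds.congr fun k => ?_)
    rw [norm_smul, norm_inv, norm_norm, inv_mul_cancel₀ (htpos k).ne']
  have hd0 : d ≠ 0 := by
    rintro rfl
    simp at hdnorm
  have hq := isLittleO_taylor_two (contDiff_lagrangian hf hh hG lam) hL0
  have hqt : Tendsto (fun k => (L (x k) - L x₀ - 1 / 2 * H (x k - x₀) (x k - x₀)) / t k ^ 2)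
      atTop (𝓝 0) := (hq.comp_tendsto hx).tendsto_div_nhds_zero
  have hHd : Tendsto (fun k => 1 / 2 * H ((t k)⁻¹ • (x k - x₀)) ((t k)⁻¹ • (x k - x₀))) atTop
      (𝓝 (1 / 2 * H d d)) := by
    have hc : Continuous fun v : X => 1 / 2 * H v v := by fun_prop
    exact (hc.tendsto d).comp hd
  have hquad : Tendsto (fun k => (L (x k) - L x₀) / t k ^ 2) atTop (𝓝 (1 / 2 * H d d)) := by
    have := hqt.add hHd
    rw [zero_add] at this
    refine this.congr fun k => ?_
    have := (htpos k).ne'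
    simp only [map_smul, smul_apply, smul_eq_mul]
    field_simp
    ring
  -- `t² b` is the room that the violated inequality leaves for the two nonnegative terms in
  -- `hmain`; convergence of `b` forces both to be `O(t²)`.
  set b : ℕ → ℝ := fun k => (s k)⁻¹ - (L (x k) - L x₀) / t k ^ 2 with hb
  have hblim : Tendsto b atTop (𝓝 (-(1 / 2 * H d d))) := by
    simpa using (tendsto_inv_atTop_zero.comp hs).sub hquad
  have hLx0 : L x₀ = f x₀ := by
    simp only [hLdef, lagrangian, hh0, inner_zero_right, add_zero]
    rw [real_inner_comm, hGlam, add_zero]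
  have hzneg : ∀ k, ⟪lam, z k⟫ = ⟪Γ, (z k).snd⟫ := fun k => by
    rw [inner_eq_fst_add_snd, (hz k).1, inner_zero_right, zero_add]
  have hmain : ∀ k, -⟪Γ, (z k).snd⟫ + s k / 2 * ‖w k‖ ^ 2 < t k ^ 2 * b k := by
    intro k
    have h1 := hlt k
    have h2 := lagrangian_eq_add_inner f h G lam (x k)
    rw [inner_sub_right, hzneg] at h1
    have h3 : t k ^ 2 * b k = (s k)⁻¹ * t k ^ 2 - (L (x k) - L x₀) := by
      have := (htpos k).ne'
      simp only [hb]
      field_simp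
    rw [h3, hLx0]
    linarith
  have hneg : ∀ k, 0 ≤ -⟪Γ, (z k).snd⟫ := fun k => by
    rw [← hzneg, neg_nonneg]
    exact inner_nonpos_of_mem_coneK (hz k) hlamneg
  -- the constraint residual is of smaller order
  have hwt : Tendsto (fun k => (t k)⁻¹ • w k) atTop (𝓝 0) := by
    have hsq : Tendsto (fun k => ‖(t k)⁻¹ • w k‖ ^ 2) atTop (𝓝 0) := by
      have hup : Tendsto (fun k => 2 * ((s k)⁻¹ * b k)) atTop (𝓝 0) := by
        simpa using ((tendsto_inv_atTop_zero.comp hs).mul hblim).const_mul 2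
      refine squeeze_zero (fun k => sq_nonneg _) (fun k => ?_) hup
      have h1 := hmain k
      have h2 := hneg k
      have h3 : s k / 2 * ‖w k‖ ^ 2 ≤ t k ^ 2 * b k := by linarith
      have hs' := hspos k
      have ht' := htpos k
      rw [norm_smul, norm_inv, Real.norm_of_nonneg ht'.le]
      have : (t k)⁻¹ ^ 2 * (2 * (s k)⁻¹) * (s k / 2 * ‖w k‖ ^ 2) ≤
          (t k)⁻¹ ^ 2 * (2 * (s k)⁻¹) * (t k ^ 2 * b k) := by gcongr
      calc _ = (t k)⁻¹ ^ 2 * (2 * (s k)⁻¹) * (s k / 2 * ‖w k‖ ^ 2) := by field_simp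
        _ ≤ _ := this
        _ = _ := by field_simp
    rw [tendsto_zero_iff_norm_tendsto_zero]
    simpa using hsq.sqrt
  have hw1 : Tendsto (fun k => (t k)⁻¹ • h (x k)) atTop (𝓝 0) := by
    have hc : Continuous fun z : WithLp 2 (Y × SymMat n) => z.fst := by fun_prop
    refine ((hc.tendsto 0).comp hwt).congr fun k => ?_
    simp [hw, constraintMap, (hz k).1]
  have hw2 : Tendsto (fun k => (t k)⁻¹ • (G (x k) - (z k).snd)) atTop (𝓝 0) := by
    have hc : Continuous fun z : WithLp 2 (Y × SymMat n) => z.snd := by fun_prop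
    refine ((hc.tendsto 0).comp hwt).congr fun k => ?_
    simp [hw, constraintMap]
  have hhd : fderiv ℝ h x₀ d = 0 := by
    refine tendsto_nhds_unique (tendsto_inv_norm_smul_sub (hh.differentiable (by norm_num) x₀) hx hne hd) (hw1.congr fun k => ?_)
    rw [hh0, sub_zero]
  set B := fderiv ℝ G x₀ d with hBdef
  -- Quotients of the slack `z` rather than of `G (x k)`: then `A + t B'` lies exactly in the cone,
  -- and the limit is unchanged because the residual is `o(t)`.
  set B' : ℕ → SymMat n := fun k => (t k)⁻¹ • ((z k).snd - A) with hB'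
  have hB'lim : Tendsto B' atTop (𝓝 B) := by
    have := (tendsto_inv_norm_smul_sub (hG.differentiable (by norm_num) x₀) hx hne hd).sub hw2
    rw [sub_zero] at this
    refine this.congr fun k => ?_
    rw [← smul_sub]
    congr 1
    abel
  have hzB : ∀ k, A + t k • B' k = (z k).snd := fun k => by
    simp only [hB']
    rw [smul_inv_smul₀ (htpos k).ne', add_sub_cancel]
  have hmem : ∀ k, A + t k • B' k ∈ psdCone n := fun k => by
    rw [hzB]
    exact (hz k).2
  have hΓB : ⟪Γ, B⟫ = 0 := by
    have hlim : Tendsto (fun k => -⟪Γ, B' k⟫) atTop (𝓝 (-⟪Γ, B⟫)) :=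
      (tendsto_const_nhds.inner hB'lim).neg
    have hΓA : ⟪Γ, A⟫ = 0 := by rw [real_inner_comm, hGlam]
    have heq : ∀ k, -⟪Γ, (z k).snd⟫ = t k * -⟪Γ, B' k⟫ := fun k => by
      have hsmul : ⟪Γ, t k • B' k⟫ = t k * ⟪Γ, B' k⟫ := real_inner_smul_right Γ (B' k) (t k)
      rw [← hzB, inner_add_right, hΓA, hsmul]
      ring
    have h0 : Tendsto (fun k => -⟪Γ, B' k⟫) atTop (𝓝 0) := by
      have hup : Tendsto (fun k => t k * b k) atTop (𝓝 0) := by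
        simpa using ht0.mul hblim
      refine squeeze_zero (fun k => ?_) (fun k => ?_) hup
      · have := hneg k
        rw [heq] at this
        exact nonneg_of_mul_nonneg_right this (htpos k)
      · have h1 := hmain k
        have h2 : 0 ≤ s k / 2 * ‖w k‖ ^ 2 := by
          have := hspos k
          positivity
        rw [heq] at h1
        have h3 : t k * -⟪Γ, B' k⟫ ≤ t k * (t k * b k) := by nlinarith
        exact le_of_mul_le_mul_left h3 (htpos k)
    exact neg_eq_zero.mp (tendsto_nhds_unique hlim h0)
  have hcrit : d ∈ criticalDirections h G x₀ lam :=
    ⟨hhd, ⟨t, B', htpos, ht0, hB'lim, hmem⟩, hΓB⟩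
  have hpos := hsosc d hcrit hd0
  have hcurv := tendsto_curvature (A := A) (Γ := Γ) ht0 hB'lim
  -- After division by `t²`, the curvature bound from below and `b` from above give `-σ/2 ≤ -(H d
  -- d)/2` in the limit, against SOSC.
  have hle := le_of_tendsto_of_tendsto' hcurv hblim fun k => by
    have h1 := sq_mul_le_neg_inner (Γ := Γ) hG0 hlamneg hGlam B (B' k) (t k) (hmem k)
    have h2 := hmain k
    have h3 : 0 ≤ s k / 2 * ‖w k‖ ^ 2 := by
      have := hspos k
      positivity
    rw [hzB k] at h1 ⊢
    exact le_of_mul_le_mul_left (by linarith) (pow_pos (htpos k) 2)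
  change 0 < H d d - sigmaTerm A Γ B at hpos
  linarith

/-- Uniform quadratic growth of the (partially minimized) augmented Lagrangian. -/
theorem exists_quadratic_growth [FiniteDimensional ℝ X] {f : X → ℝ} {h : X → Y} {G : X → SymMat n}
    (hf : ContDiff ℝ 2 f) (hh : ContDiff ℝ 2 h) (hG : ContDiff ℝ 2 G)
    {x₀ : X} {lam : WithLp 2 (Y × SymMat n)} (hlam : lam ∈ multipliers f h G x₀)
    (hsosc : SOSC f h G x₀ lam) :
    ∃ c : ℝ, 0 < c ∧ ∀ x ∈ Metric.closedBall x₀ c, ∀ z ∈ coneK Y n,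
      f x₀ + c * ‖x - x₀‖ ^ 2 ≤ f x + ⟪lam, constraintMap h G x - z⟫
        + c⁻¹ / 2 * ‖constraintMap h G x - z‖ ^ 2 := by
  by_contra! hcon
  -- The single constant `1 / (k + 1)` serves as radius, growth modulus and inverse penalty.
  choose! x hx z hz hlt using fun k : ℕ => hcon ((k : ℝ) + 1)⁻¹ (by positivity)
  have hne : ∀ k, x k ≠ x₀ := by
    intro k hk
    have h1 := hlt k
    have h2 := inner_nonpos_of_mem_coneK (hz k) hlam.2.2.2.2
    have h3 := lagrangian_eq_add_inner f h G lam x₀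
    have h4 : ⟪lam, constraintMap h G x₀⟫ = 0 := by
      rw [inner_eq_fst_add_snd, constraintMap]
      simp only [WithLp.toLp_fst, WithLp.toLp_snd, hlam.2.1, inner_zero_right, zero_add]
      rw [real_inner_comm, hlam.2.2.2.1]
    rw [hk, inner_sub_right, h4, sub_self, norm_zero] at h1
    have h5 : 0 ≤ ((k : ℝ) + 1)⁻¹⁻¹ / 2 * ‖constraintMap h G x₀ - z k‖ ^ 2 := by positivity
    linarith
  have hxlim : Tendsto x atTop (𝓝 x₀) := by
    rw [tendsto_iff_dist_tendsto_zero]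
    refine squeeze_zero (fun _ => dist_nonneg) (fun k => hx k) ?_
    simpa using tendsto_one_div_add_atTop_nhds_zero_nat (𝕜 := ℝ)
  obtain ⟨d, -, φ, hφ, hd⟩ := (isCompact_sphere (0 : X) 1).tendsto_subseq
    (x := fun k => ‖x k - x₀‖⁻¹ • (x k - x₀)) fun k => by
      rw [mem_sphere_zero_iff_norm, norm_smul, norm_inv, norm_norm,
        inv_mul_cancel₀ (norm_ne_zero_iff.mpr (sub_ne_zero.mpr (hne k)))]
  refine false_of_seq hf hh hG hlam hsosc (x := x ∘ φ) (z := z ∘ φ)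
    (s := fun k => (φ k : ℝ) + 1) ?_ (fun k => by positivity) (hxlim.comp hφ.tendsto_atTop)
    (fun k => hne _) hd (fun k => hz _) fun k => ?_
  · exact tendsto_atTop_add_const_right _ _
      (tendsto_natCast_atTop_atTop.comp hφ.tendsto_atTop)
  · simpa using hlt (φ k)

end

end

end NLSDP

/-! ### Perturbation of the multiplier. -/

theorem mainTheorem6
    {X Y : Type*} [NormedAddCommGroup X] [InnerProductSpace ℝ X] [FiniteDimensional ℝ X]
    [NormedAddCommGroup Y] [InnerProductSpace ℝ Y] [FiniteDimensional ℝ Y] {n : ℕ}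
    (f : X → ℝ) (h : X → Y) (G : X → NLSDP.SymMat n)
    (hf : ContDiff ℝ 2 f) (hh : ContDiff ℝ 2 h) (hG : ContDiff ℝ 2 G)
    (xbar : X) (lambar : WithLp 2 (Y × NLSDP.SymMat n))
    (hstat : NLSDP.IsStationary f h G xbar)
    (hlam : lambar ∈ NLSDP.multipliers f h G xbar)
    (hsosc : NLSDP.SOSC f h G xbar lambar) :
    ∃ τ ρ₃ r : ℝ, 0 < τ ∧ 0 < ρ₃ ∧ 0 < r ∧
      ∀ ρ : ℝ, ρ₃ ≤ ρ → ∀ lam ∈ Metric.closedBall lambar (r / (2 * τ)),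
        (NLSDP.localSolutions f h G xbar r lam ρ).Nonempty ∧
        NLSDP.localSolutions f h G xbar r lam ρ ⊆ interior (Metric.closedBall xbar r) ∧
        NLSDP.localSolutions f h G xbar r lam ρ ⊆
          Metric.closedBall xbar (τ * ‖lam - lambar‖) := by
  obtain ⟨c, hc, hgrow⟩ := NLSDP.exists_quadratic_growth hf hh hG hlam hsosc
  have hτ : 0 < √(1 / (2 * c)) := Real.sqrt_pos.mpr (by positivity)
  set τ := √(1 / (2 * c)) with hτdef
  have hτsq : τ ^ 2 = 1 / (2 * c) := Real.sq_sqrt (by positivity)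
  -- The penalty `c⁻¹` is spent on growth; the extra `1` pays for `‖lam - lambar‖ ‖w‖` through
  -- Young's inequality, leaving `‖lam - lambar‖² / 2`, whence `τ² = 1 / (2c)`.
  refine ⟨τ, c⁻¹ + 1, c, hτ, by positivity, hc, fun ρ hρ lam hlamball => ?_⟩
  have hρ0 : 0 < ρ := lt_of_lt_of_le (by positivity) hρ
  have hxbarK : NLSDP.constraintMap h G xbar ∈ NLSDP.coneK Y n := ⟨hlam.2.1, hlam.2.2.1⟩
  -- expanding the square in the augmented Lagrangian
  have hexpand : ∀ v : WithLp 2 (Y × NLSDP.SymMat n),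
      ρ / 2 * ‖v + ρ⁻¹ • lam‖ ^ 2 - ‖lam‖ ^ 2 / (2 * ρ) = ⟪lam, v⟫ + ρ / 2 * ‖v‖ ^ 2 := by
    intro v
    have hsmul : ⟪v, ρ⁻¹ • lam⟫ = ρ⁻¹ * ⟪v, lam⟫ := real_inner_smul_right v lam ρ⁻¹
    rw [norm_add_sq_real, hsmul, norm_smul, norm_inv, Real.norm_of_nonneg hρ0.le,
      real_inner_comm]
    field_simp
    ring
  have hbound : ∀ u ∈ NLSDP.localSolutions f h G xbar c lam ρ,
      ‖u - xbar‖ ≤ τ * ‖lam - lambar‖ := by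
    intro u hu
    obtain ⟨z, hz, hdist⟩ := NLSDP.isClosed_coneK.exists_infDist_eq_dist ⟨_, hxbarK⟩
      (NLSDP.constraintMap h G u + ρ⁻¹ • lam)
    have hmin : NLSDP.augLagrangian f h G lam ρ u ≤ NLSDP.augLagrangian f h G lam ρ xbar :=
      hu.2 (Metric.mem_closedBall_self hc.le)
    set w := NLSDP.constraintMap h G u - z with hw
    have h1 : NLSDP.augLagrangian f h G lam ρ u = f u + ⟪lam, w⟫ + ρ / 2 * ‖w‖ ^ 2 := by
      have hwz : NLSDP.constraintMap h G u + ρ⁻¹ • lam - z = w + ρ⁻¹ • lam := by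
        rw [hw]
        abel
      rw [NLSDP.augLagrangian, hdist, dist_eq_norm, hwz, add_sub_assoc, hexpand, add_assoc]
    have h2 : NLSDP.augLagrangian f h G lam ρ xbar ≤ f xbar := by
      have hle := Metric.infDist_le_dist_of_mem (x := NLSDP.constraintMap h G xbar + ρ⁻¹ • lam)
        hxbarK
      rw [dist_eq_norm, add_sub_cancel_left] at hle
      have hsq := pow_le_pow_left₀ Metric.infDist_nonneg hle 2
      have h0 := hexpand 0
      simp only [zero_add, inner_zero_right, norm_zero] at h0
      rw [NLSDP.augLagrangian]
      -- Testing with `z = Φ xbar` leaves `dist ≤ ‖lam / ρ‖`, and the subtracted `‖lam‖² / (2ρ)`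
      -- cancels it exactly.
      nlinarith [mul_le_mul_of_nonneg_left hsq (show 0 ≤ ρ / 2 by positivity)]
    have h3 := hgrow u hu.1 z hz
    rw [← hw] at h3
    have h4 : ⟪lambar, w⟫ - ⟪lam, w⟫ ≤ ‖lam - lambar‖ * ‖w‖ := by
      rw [← inner_sub_left, ← norm_sub_rev]
      exact real_inner_le_norm _ _
    have h5 : (c⁻¹ + 1) / 2 * ‖w‖ ^ 2 ≤ ρ / 2 * ‖w‖ ^ 2 := by gcongr
    have h6 : c * ‖u - xbar‖ ^ 2 ≤ ‖lam - lambar‖ ^ 2 / 2 := by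
      nlinarith [sq_nonneg (‖lam - lambar‖ - ‖w‖)]
    refine le_of_pow_le_pow_left₀ two_ne_zero (by positivity) ?_
    rw [mul_pow, hτsq]
    calc ‖u - xbar‖ ^ 2 = (c * ‖u - xbar‖ ^ 2) / c := by field_simp
      _ ≤ (‖lam - lambar‖ ^ 2 / 2) / c := by gcongr
      _ = _ := by field_simp
  refine ⟨?_, fun u hu => ?_, fun u hu => ?_⟩
  · have hcont : Continuous (NLSDP.augLagrangian f h G lam ρ) := by
      have c1 := hf.continuous
      have c2 := hh.continuous
      have c3 := hG.continuous
      have c4 : Continuous (NLSDP.constraintMap h G) := by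
        unfold NLSDP.constraintMap
        fun_prop
      have c5 : Continuous fun x => Metric.infDist (NLSDP.constraintMap h G x + ρ⁻¹ • lam)
          (NLSDP.coneK Y n) := (Metric.continuous_infDist_pt _).comp (by fun_prop)
      unfold NLSDP.augLagrangian
      fun_prop
    obtain ⟨u, hu, hmin⟩ := (isCompact_closedBall xbar c).exists_isMinOn
      ⟨xbar, Metric.mem_closedBall_self hc.le⟩ hcont.continuousOn
    exact ⟨u, hu, hmin⟩
  · refine Metric.ball_subset_interior_closedBall ?_
    rw [Metric.mem_ball, dist_eq_norm]
    rw [Metric.mem_closedBall, dist_eq_norm] at hlamball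
    -- The radius `r / (2τ)` for `lam` keeps `u` within half of `r`, hence in the interior.
    calc ‖u - xbar‖ ≤ τ * ‖lam - lambar‖ := hbound u hu
      _ ≤ τ * (c / (2 * τ)) := by gcongr
      _ = c / 2 := by field_simp
      _ < c := by linarith
  · rw [Metric.mem_closedBall, dist_eq_norm]
    exact hbound u hu
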